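/- Let $m,n\in\mathbb N$, let $G\in\mathbb R^{m\times n}$, and let $\Gamma_X\in\mathbb R^{n\times n}$ and $\Gamma_{Y|X}\in\mathbb R^{m\times m}$ be symmetric positive definite. Let $X\sim\mathcal N(0,\Gamma_X)$ and $\epsilon\sim\mathcal N(0,\Gamma_{Y|X})$ be independent, put $Y=GX+\epsilon$, and let $\Gamma_Y:=G\Gamma_XG^\top+\Gamma_{Y|X}$ be the covariance matrix of $Y$. A selection operator is a matrix $\mathcal P=[e_{i_1},\dots,e_{i_k}]\in\mathbb R^{m\times k}$ whose columns are distinct canonical unit vectors of $\mathbb R^m$; its index set is $\{i_1,\dots,i_k\}$, and $Y_{\mathcal P}:=\mathcal P^\top Y=[Y_{i_1},\dots,Y_{i_k}]^\top$. The mutual information $\mathcal I(X;Y_{\mathcal P})$ is the Kullback--Leibler divergence of the joint law of $(X,Y_{\mathcal P})$ from the product of the laws of $X$ and $Y_{\mathcal P}$. Below, $\log$ of a positive definite matrix is the matrix logarithm, and $\mathrm{diag}(A)$ is the diagonal matrix with the same diagonal as $A$. A function $F$ of subsets of $\{1,\dots,m\}$ is modular if there is $s\in\mathbb R^m$ with $F(A)=\sum_{a\in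 A}s_a$ for all $A$. Then, for every selection operator $\mathcal P$, $\mathcal I(X;Y_{\mathcal P})$ is finite and $$\tfrac12\operatorname{tr}\!\big(\mathcal P^\top(\log\Gamma_Y-\log\mathrm{diag}(\Gamma_{Y|X}))\mathcal P\big)\;\le\;\mathcal I(X;Y_{\mathcal P})\;\le\;\tfrac12\operatorname{tr}\!\big(\mathcal P^\top(\log\mathrm{diag}(\Gamma_Y)-\log\Gamma_{Y|X})\mathcal P\big).$$ Moreover, let $0<\alpha_s\le\alpha_l$ and $0<\beta_s\le\beta_l$ be such that all eigenvalues of $\Gamma_{Y|X}$ lie in $[\alpha_s,\alpha_l]$ and all eigenvalues of $\Gamma_Y$ lie in $[\beta_s,\beta_l]$, and put $\varrho_1:=\frac{4\alpha_s\alpha_l}{(\alpha_s+\alpha_l)^2}$ and $\varrho_2:=\frac{4\beta_s\beta_l}{(\beta_s+\beta_l)^2}$. Then $\varrho_1,\varrho_2\in(0,1]$ and, for every selection operator $\mathcal P$, $$\tfrac12\operatorname{tr}\!\big(\mathcal P^\top(\log\Gamma_Y-\log\Gamma_{Y|X}+I_m\log\varrho_1)\mathcal P\big)\;\le\;\mathcal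 I(X;Y_{\mathcal P})\;\le\;\tfrac12\operatorname{tr}\!\big(\mathcal P^\top(\log\Gamma_Y-I_m\log\varrho_2-\log\Gamma_{Y|X})\mathcal P\big).$$ Each of the four bounds, as $\mathcal P$ ranges over the selection operators, depends only on the index set of $\mathcal P$ and is a modular function of it. -/

import Mathlib

open MeasureTheory ProbabilityTheory Matrix
open scoped ENNReal

noncomputable section

/-- Mutual information `I(X; Z)`: the Kullback-Leibler divergence between the joint law of `(X, Z)`
and the product of the marginal laws. -/
def mutualInformation {Ω E F : Type*} [MeasurableSpace Ω] [MeasurableSpace E] [MeasurableSpace F]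
    (X : Ω → E) (Z : Ω → F) (μ : Measure Ω) : ℝ≥0∞ :=
  InformationTheory.klDiv (μ.map (fun ω => (X ω, Z ω))) ((μ.map X).prod (μ.map Z))

/-- `P = [e_{i_1}, ..., e_{i_k}]` with distinct canonical unit vectors `e_{i_j}` of `ℝ^m`. -/
def IsSelectionOperator {m k : ℕ} (P : Matrix (Fin m) (Fin k) ℝ) : Prop :=
  ∃ i : Fin k → Fin m, Function.Injective i ∧ ∀ a j, P a j = if a = i j then 1 else 0

open Classical in
/-- The index set `{i_1, ..., i_k}` of a selection operator. -/
def selectionIndexSet {m k : ℕ} (P : Matrix (Fin m) (Fin k) ℝ) : Finset (Fin m) :=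
  Finset.univ.filter (fun a => ∃ j, P a j = 1)

/-- The selected observations `Y_P = Pᵀ Y`. -/
def selectObservations {Ω : Type*} {m k : ℕ} (P : Matrix (Fin m) (Fin k) ℝ)
    (Y : Ω → EuclideanSpace ℝ (Fin m)) : Ω → EuclideanSpace ℝ (Fin k) :=
  fun ω => WithLp.toLp 2 (Pᵀ *ᵥ (Y ω).ofLp)

/-- The matrix logarithm of a symmetric matrix, `log (U Σ Uᵀ) = U (log Σ) Uᵀ`. -/
def matrixLog {m : ℕ} (A : Matrix (Fin m) (Fin m) ℝ) : Matrix (Fin m) (Fin m) ℝ :=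
  cfc Real.log A

/-- `diag(A)`: the diagonal matrix with the same diagonal as `A`. -/
def diagPart {m : ℕ} (A : Matrix (Fin m) (Fin m) ℝ) : Matrix (Fin m) (Fin m) ℝ :=
  Matrix.diagonal A.diag

/-- A modular set function: `F(A) = ∑_{a ∈ A} s_a` for some vector `s`. -/
def IsModularSetFunction {m : ℕ} (F : Finset (Fin m) → ℝ) : Prop :=
  ∃ s : Fin m → ℝ, ∀ A, F A = ∑ a ∈ A, s a

/-- `½ tr(Pᵀ M P)`. -/
def halfTrace {m k : ℕ} (M : Matrix (Fin m) (Fin m) ℝ) (P : Matrix (Fin m) (Fin k) ℝ) : ℝ :=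
  1 / 2 * Matrix.trace (Pᵀ * M * P)

/-- `½ tr(Pᵀ M P)`, over all selection operators `P`, is a modular function of the index set. -/
def HalfTraceIsModular {m : ℕ} (M : Matrix (Fin m) (Fin m) ℝ) : Prop :=
  ∃ F : Finset (Fin m) → ℝ, IsModularSetFunction F ∧
    ∀ (k : ℕ) (P : Matrix (Fin m) (Fin k) ℝ), IsSelectionOperator P →
      halfTrace M P = F (selectionIndexSet P)

/-- The covariance `Γ_Y = G Γ_X Gᵀ + Γ_{Y|X}` of the data in the linear model `Y = G X + ε`. -/
def dataCovariance {n m : ℕ} (G : Matrix (Fin m) (Fin n) ℝ) (ΓX : Matrix (Fin n) (Fin n) ℝ)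
    (Γε : Matrix (Fin m) (Fin m) ℝ) : Matrix (Fin m) (Fin m) ℝ :=
  G * ΓX * Gᵀ + Γε

/-- The Kantorovich constant `4 s l / (s + l)²` of the interval `[s, l]`. -/
def kantorovichConstant (s l : ℝ) : ℝ := 4 * s * l / (s + l) ^ 2

end

/-! Applying `Pᵀ` to the model gives another Gaussian linear model, with covariances `Pᵀ Γ_Y P` and
`Pᵀ Γ_{Y|X} P`. Its mutual information is half the difference of their log-determinants
(`mutualInformation_selectObservations`), so everything reduces to comparing `log det (Pᵀ A P)` with
traces of compressed logarithms, for `A` positive definite and `Pᵀ P = 1`.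

Three comparisons suffice. Jensen's inequality in the spectral weights of `A`, at the eigenvectors
of the compression, gives `tr (Pᵀ log A P) ≤ log det (Pᵀ A P)` (`trace_compression_matrixLog_le`).
Kantorovich's inequality reverses it at the cost of `log ϱ` per selected index
(`log_det_compression_add_le`). For selection operators, Hadamard's inequality gives the upper bound
`tr (Pᵀ log diag(A) P)`. Each of the four bounds applies Jensen to one covariance and Hadamard or
Kantorovich to the other. -/

/-! ### Spectral weights; Jensen and Kantorovich inequalities for weighted means. -/

lemma dotProduct_cfc_mulVec {ι : Type*} [Fintype ι] [DecidableEq ι] {A : Matrix ι ι ℝ}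
    (hA : A.IsHermitian) (f : ℝ → ℝ) (u : ι → ℝ) :
    u ⬝ᵥ (cfc f A *ᵥ u) = ∑ i, ((star (hA.eigenvectorUnitary : Matrix ι ι ℝ)) *ᵥ u) i ^ 2 *
      f (hA.eigenvalues i) := by
  rw [hA.cfc_eq, Matrix.IsHermitian.cfc, Unitary.conjStarAlgAut_apply, ← mulVec_mulVec,
    ← mulVec_mulVec, dotProduct_mulVec, ← mulVec_transpose]
  have : (hA.eigenvectorUnitary : Matrix ι ι ℝ)ᵀ = star (hA.eigenvectorUnitary : Matrix ι ι ℝ) := by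
    rw [star_eq_conjTranspose, conjTranspose_eq_transpose_of_trivial]
  rw [this]
  simp only [dotProduct, mulVec_diagonal]
  refine Finset.sum_congr rfl fun i _ => ?_
  simp only [Function.comp, RCLike.ofReal_real_eq_id, id]
  ring

/-- The weights are the squared coordinates of `u` in an eigenbasis. They do not depend on `f`, so
the quadratic forms of `A` and `log A` are means under the same probability vector. -/
lemma exists_spectral_weights {ι : Type*} [Fintype ι] [DecidableEq ι] {A : Matrix ι ι ℝ}
    (hA : A.IsHermitian) {u : ι → ℝ} (hu : u ⬝ᵥ u = 1) :
    ∃ w : ι → ℝ, (∀ i, 0 ≤ w i) ∧ ∑ i, w i = 1 ∧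
      ∀ f : ℝ → ℝ, u ⬝ᵥ (cfc f A *ᵥ u) = ∑ i, w i * f (hA.eigenvalues i) := by
  refine ⟨fun i => ((star (hA.eigenvectorUnitary : Matrix ι ι ℝ)) *ᵥ u) i ^ 2,
    fun i => sq_nonneg _, ?_, fun f => dotProduct_cfc_mulVec hA f u⟩
  have h := dotProduct_cfc_mulVec hA (fun _ => 1) u
  have h1 : cfc (fun _ : ℝ => (1 : ℝ)) A = 1 := cfc_const_one ℝ A (ha := hA.isSelfAdjoint)
  rw [h1, one_mulVec, hu] at h
  simpa using h.symm

lemma sum_mul_log_le_log_sum {ι : Type*} [Fintype ι] {w a : ι → ℝ} (hw : ∀ i, 0 ≤ w i)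
    (hw1 : ∑ i, w i = 1) (ha : ∀ i, 0 < a i) :
    ∑ i, w i * Real.log (a i) ≤ Real.log (∑ i, w i * a i) := by
  simpa using strictConcaveOn_log_Ioi.concaveOn.le_map_sum (t := Finset.univ) (w := w) (p := a)
    (fun i _ => hw i) hw1 (fun i _ => ha i)

lemma sum_mul_pos_of_weights {ι : Type*} [Fintype ι] {w a : ι → ℝ} (hw : ∀ i, 0 ≤ w i)
    (hw1 : ∑ i, w i = 1) (ha : ∀ i, 0 < a i) : 0 < ∑ i, w i * a i := by
  simpa using (convex_Ioi (0 : ℝ)).sum_mem (t := Finset.univ) (w := w) (z := a)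
    (fun i _ => hw i) hw1 (fun i _ => ha i)

lemma kantorovichConstant_pos {s l : ℝ} (hs : 0 < s) (hl : s ≤ l) : 0 < kantorovichConstant s l := by
  have : 0 < l := hs.trans_le hl
  unfold kantorovichConstant
  positivity

lemma kantorovichConstant_le_one {s l : ℝ} (hs : 0 < s) (hl : s ≤ l) :
    kantorovichConstant s l ≤ 1 := by
  have : 0 < l := hs.trans_le hl
  unfold kantorovichConstant
  rw [div_le_one (by positivity)]
  nlinarith [sq_nonneg (s - l)]

/-- **Kantorovich's inequality** for weighted means. -/
lemma kantorovichConstant_mul_sum_mul_sum_inv_le {ι : Type*} [Fintype ι] {w a : ι → ℝ} {s l : ℝ}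
    (hs : 0 < s) (hl : s ≤ l) (hw : ∀ i, 0 ≤ w i) (hw1 : ∑ i, w i = 1)
    (ha : ∀ i, a i ∈ Set.Icc s l) :
    kantorovichConstant s l * ((∑ i, w i * a i) * ∑ i, w i * (a i)⁻¹) ≤ 1 := by
  have hl0 : 0 < l := hs.trans_le hl
  -- Average of the pointwise bound `a + s l / a ≤ s + l`, which is `(a - s) (l - a) ≥ 0` divided by
  -- `a`.
  have h : (∑ i, w i * a i) + s * l * ∑ i, w i * (a i)⁻¹ ≤ s + l := by
    calc _ = ∑ i, w i * (a i + s * l * (a i)⁻¹) := by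
          rw [Finset.mul_sum, ← Finset.sum_add_distrib]
          exact Finset.sum_congr rfl fun i _ => by ring
      _ ≤ ∑ i, w i * (s + l) := by
          refine Finset.sum_le_sum fun i _ => mul_le_mul_of_nonneg_left ?_ (hw i)
          have hai := hs.trans_le (ha i).1
          have : s + l - (a i + s * l * (a i)⁻¹) = (a i - s) * (l - a i) / a i := by
            field_simp; ring
          have : 0 ≤ (a i - s) * (l - a i) / a i :=
            div_nonneg (mul_nonneg (sub_nonneg.2 (ha i).1) (sub_nonneg.2 (ha i).2)) hai.le
          linarith
      _ = s + l := by rw [← Finset.sum_mul, hw1, one_mul]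
  have h0 : 0 < ∑ i, w i * a i :=
    sum_mul_pos_of_weights hw hw1 fun i => hs.trans_le (ha i).1
  have h1 : 0 < ∑ i, w i * (a i)⁻¹ :=
    sum_mul_pos_of_weights hw hw1 fun i => inv_pos.2 (hs.trans_le (ha i).1)
  generalize (∑ i, w i * a i) = p at *
  generalize (∑ i, w i * (a i)⁻¹) = q at *
  unfold kantorovichConstant
  rw [div_mul_eq_mul_div, div_le_one (by positivity)]
  have h2 : (p + s * l * q) ^ 2 ≤ (s + l) ^ 2 := by gcongr
  -- AM-GM: `4 p (s l q) ≤ (p + s l q)² ≤ (s + l)²`.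
  nlinarith [sq_nonneg (p - s * l * q)]

/-- A reverse Jensen inequality: Kantorovich bounds the left side by `-log ∑ w/a`, and Jensen
applied to the inverses bounds that by `∑ w log a`. -/
lemma log_sum_add_log_kantorovichConstant_le {ι : Type*} [Fintype ι] {w a : ι → ℝ} {s l : ℝ}
    (hs : 0 < s) (hl : s ≤ l) (hw : ∀ i, 0 ≤ w i) (hw1 : ∑ i, w i = 1)
    (ha : ∀ i, a i ∈ Set.Icc s l) :
    Real.log (∑ i, w i * a i) + Real.log (kantorovichConstant s l) ≤
      ∑ i, w i * Real.log (a i) := by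
  have ha0 : ∀ i, 0 < a i := fun i => hs.trans_le (ha i).1
  have h0 := sum_mul_pos_of_weights hw hw1 ha0
  have h1 := sum_mul_pos_of_weights hw hw1 fun i => inv_pos.2 (ha0 i)
  have hk := kantorovichConstant_pos hs hl
  have h2 := Real.log_nonpos (by positivity)
    (kantorovichConstant_mul_sum_mul_sum_inv_le hs hl hw hw1 ha)
  rw [Real.log_mul hk.ne' (by positivity), Real.log_mul h0.ne' h1.ne'] at h2
  have h3 := sum_mul_log_le_log_sum hw hw1 fun i => inv_pos.2 (ha0 i)
  simp only [Real.log_inv, mul_neg, Finset.sum_neg_distrib] at h3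
  linarith

/-! ### Log-determinants and traces of logarithms of compressions. -/

lemma dotProduct_matrixLog_mulVec_le {m : ℕ} {A : Matrix (Fin m) (Fin m) ℝ} (hA : A.PosDef)
    {u : Fin m → ℝ} (hu : u ⬝ᵥ u = 1) :
    u ⬝ᵥ (matrixLog A *ᵥ u) ≤ Real.log (u ⬝ᵥ (A *ᵥ u)) := by
  obtain ⟨w, hw, hw1, h⟩ := exists_spectral_weights hA.isHermitian hu
  have hid := h id
  rw [cfc_id ℝ A hA.isHermitian.isSelfAdjoint] at hid
  rw [matrixLog, h, hid]
  exact sum_mul_log_le_log_sum hw hw1 hA.eigenvalues_pos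

lemma log_dotProduct_mulVec_add_le {m : ℕ} {A : Matrix (Fin m) (Fin m) ℝ} (hA : A.PosDef)
    {s l : ℝ} (hs : 0 < s) (hl : s ≤ l) (hspec : spectrum ℝ A ⊆ Set.Icc s l)
    {u : Fin m → ℝ} (hu : u ⬝ᵥ u = 1) :
    Real.log (u ⬝ᵥ (A *ᵥ u)) + Real.log (kantorovichConstant s l) ≤
      u ⬝ᵥ (matrixLog A *ᵥ u) := by
  obtain ⟨w, hw, hw1, h⟩ := exists_spectral_weights hA.isHermitian hu
  have hid := h id
  rw [cfc_id ℝ A hA.isHermitian.isSelfAdjoint] at hid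
  rw [matrixLog, h, hid]
  exact log_sum_add_log_kantorovichConstant_le hs hl hw hw1
    fun i => hspec (hA.isHermitian.eigenvalues_mem_spectrum_real i)

lemma trace_matrixLog {k : ℕ} {B : Matrix (Fin k) (Fin k) ℝ} (hB : B.PosDef) :
    (matrixLog B).trace = Real.log B.det := by
  rw [matrixLog, hB.isHermitian.cfc_eq, Matrix.IsHermitian.cfc, Unitary.conjStarAlgAut_apply,
    trace_mul_comm, ← mul_assoc, hB.isHermitian.det_eq_prod_eigenvalues]
  simp [Matrix.trace, Real.log_prod, (hB.eigenvalues_pos _).ne']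

/-- An isometry diagonalizing the compression `Pᵀ A P`. -/
lemma exists_isometry_diagonalizing {m k : ℕ} {A : Matrix (Fin m) (Fin m) ℝ}
    {P : Matrix (Fin m) (Fin k) ℝ} (hP : Pᵀ * P = 1) (hB : (Pᵀ * A * P).PosDef) :
    ∃ v : Fin k → Fin m → ℝ, (∀ j, v j ⬝ᵥ v j = 1) ∧
      (∑ j, Real.log (v j ⬝ᵥ (A *ᵥ v j)) = Real.log (Pᵀ * A * P).det) ∧
      ∀ M : Matrix (Fin m) (Fin m) ℝ, (Pᵀ * M * P).trace = ∑ j, v j ⬝ᵥ (M *ᵥ v j) := by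
  -- The vectors `v j` are the columns of `P * U`, where `U` holds the eigenvectors of `Pᵀ A P`.
  set U : Matrix (Fin k) (Fin k) ℝ := hB.isHermitian.eigenvectorUnitary.1 with hU
  have hUT : Uᵀ = star U := by
    rw [star_eq_conjTranspose, conjTranspose_eq_transpose_of_trivial]
  have hUU : U * Uᵀ = 1 := by rw [hUT, hU]; simp
  have hUU' : Uᵀ * U = 1 := by rw [hUT, hU]; simp
  have key : ∀ (M : Matrix (Fin m) (Fin m) ℝ) j,
      (fun a => (P * U) a j) ⬝ᵥ (M *ᵥ fun a => (P * U) a j) = (Uᵀ * (Pᵀ * M * P) * U) j j := by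
    intro M j
    have : Uᵀ * (Pᵀ * M * P) * U = (P * U)ᵀ * (M * (P * U)) := by
      simp only [transpose_mul, Matrix.mul_assoc]
    rw [this]
    rfl
  refine ⟨fun j a => (P * U) a j, fun j => ?_, ?_, fun M => ?_⟩
  · have := key 1 j
    rw [one_mulVec, Matrix.mul_one, hP, Matrix.mul_one, hUU', one_apply_eq] at this
    exact this
  · rw [hB.isHermitian.det_eq_prod_eigenvalues]
    simp only [RCLike.ofReal_real_eq_id, id]
    rw [Real.log_prod fun i _ => (hB.eigenvalues_pos i).ne']
    refine Finset.sum_congr rfl fun j _ => ?_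
    have h := hB.isHermitian.conjStarAlgAut_star_eigenvectorUnitary
    rw [Unitary.conjStarAlgAut_star_apply] at h
    rw [key, hUT, hU, h]
    simp
  · simp only [key]
    change _ = (Uᵀ * (Pᵀ * M * P) * U).trace
    rw [trace_mul_comm (Uᵀ * _), ← Matrix.mul_assoc, hUU, Matrix.one_mul]

lemma trace_compression_matrixLog_le {m k : ℕ} {A : Matrix (Fin m) (Fin m) ℝ} (hA : A.PosDef)
    {P : Matrix (Fin m) (Fin k) ℝ} (hP : Pᵀ * P = 1) (hB : (Pᵀ * A * P).PosDef) :
    (Pᵀ * matrixLog A * P).trace ≤ Real.log (Pᵀ * A * P).det := by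
  obtain ⟨v, hv, h1, h2⟩ := exists_isometry_diagonalizing hP hB
  rw [h2, ← h1]
  exact Finset.sum_le_sum fun j _ => dotProduct_matrixLog_mulVec_le hA (hv j)

lemma log_det_compression_add_le {m k : ℕ} {A : Matrix (Fin m) (Fin m) ℝ} (hA : A.PosDef)
    {s l : ℝ} (hs : 0 < s) (hl : s ≤ l) (hspec : spectrum ℝ A ⊆ Set.Icc s l)
    {P : Matrix (Fin m) (Fin k) ℝ} (hP : Pᵀ * P = 1) (hB : (Pᵀ * A * P).PosDef) :
    Real.log (Pᵀ * A * P).det + k * Real.log (kantorovichConstant s l) ≤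
      (Pᵀ * matrixLog A * P).trace := by
  obtain ⟨v, hv, h1, h2⟩ := exists_isometry_diagonalizing hP hB
  rw [h2, ← h1]
  calc _ = ∑ j, (Real.log (v j ⬝ᵥ (A *ᵥ v j)) + Real.log (kantorovichConstant s l)) := by
        simp [Finset.sum_add_distrib]
    _ ≤ _ := Finset.sum_le_sum fun j _ => log_dotProduct_mulVec_add_le hA hs hl hspec (hv j)

/-- **Hadamard's inequality**, in logarithmic form. -/
lemma log_det_le_sum_log_diag {k : ℕ} {B : Matrix (Fin k) (Fin k) ℝ} (hB : B.PosDef) :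
    Real.log B.det ≤ ∑ j, Real.log (B j j) := by
  rw [← trace_matrixLog hB]
  refine Finset.sum_le_sum fun j _ => ?_
  -- Jensen at the standard basis vectors, where the quadratic form of `B` is its diagonal entry.
  simpa using dotProduct_matrixLog_mulVec_le hB (u := Pi.single j 1) (by simp)

/-- The eigenvalue enumeration need not match the order of `d`. At the `i`-th basis vector the
spectral weights have mean `d i` and second moment `(d i)²`, hence zero variance, so they charge
only eigenvalues equal to `d i`. -/
lemma cfc_diagonal_apply_self {m : ℕ} (f : ℝ → ℝ) (d : Fin m → ℝ) (i : Fin m) :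
    cfc f (diagonal d) i i = f (d i) := by
  have hD : (diagonal d : Matrix (Fin m) (Fin m) ℝ).IsHermitian := by
    simp [Matrix.IsHermitian]
  obtain ⟨w, hw, hw1, h⟩ := exists_spectral_weights hD (u := Pi.single i 1) (by simp)
  have hf : ∀ M : Matrix (Fin m) (Fin m) ℝ,
      Pi.single i 1 ⬝ᵥ (M *ᵥ Pi.single i 1) = M i i := by simp
  simp only [hf] at h
  have h1 := h id
  have h2 := h (· ^ 2)
  rw [cfc_id ℝ _ hD.isSelfAdjoint, diagonal_apply_eq] at h1
  rw [cfc_pow_id _ 2 hD.isSelfAdjoint, pow_two, diagonal_mul_diagonal, diagonal_apply_eq] at h2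
  have h3 : ∑ j, w j * (hD.eigenvalues j - d i) ^ 2 = 0 := by
    calc _ = (∑ j, w j * hD.eigenvalues j ^ 2) - 2 * d i * (∑ j, w j * id (hD.eigenvalues j))
          + (d i) ^ 2 * ∑ j, w j := by
          simp only [Finset.mul_sum, ← Finset.sum_sub_distrib, ← Finset.sum_add_distrib, id]
          exact Finset.sum_congr rfl fun j _ => by ring
      _ = 0 := by rw [← h1, ← h2, hw1]; ring
  rw [Finset.sum_eq_zero_iff_of_nonneg fun j _ => mul_nonneg (hw j) (sq_nonneg _)] at h3
  rw [h]
  calc _ = ∑ j, w j * f (d i) := by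
        refine Finset.sum_congr rfl fun j hj => ?_
        rcases mul_eq_zero.1 (h3 j hj) with h0 | h0
        · rw [h0]; ring
        · rw [sub_eq_zero.1 (pow_eq_zero_iff two_ne_zero |>.1 h0)]
    _ = f (d i) := by rw [← Finset.sum_mul, hw1, one_mul]

lemma matrixLog_diagPart_apply_self {m : ℕ} (A : Matrix (Fin m) (Fin m) ℝ) (i : Fin m) :
    matrixLog (diagPart A) i i = Real.log (A i i) :=
  cfc_diagonal_apply_self Real.log A.diag i

/-! ### Gaussian densities and the relative entropy of a sheared product. -/

section GaussianDensity

variable {E : Type*} [NormedAddCommGroup E] [InnerProductSpace ℝ E]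

/-- The logarithm of the Lebesgue density of the image of the standard Gaussian under `L`. -/
noncomputable def gaussianLogDensity (L : E ≃L[ℝ] E) (x : E) : ℝ :=
  -(Module.finrank ℝ E / 2 * Real.log (2 * Real.pi)) -
    Real.log |LinearMap.det (L : E →ₗ[ℝ] E)| - ‖L.symm x‖ ^ 2 / 2

lemma exp_gaussianLogDensity_refl (x : E) :
    Real.exp (gaussianLogDensity (ContinuousLinearEquiv.refl ℝ E) x) =
      (2 * Real.pi) ^ (-(Module.finrank ℝ E / 2 : ℝ)) * Real.exp (-(1 / 2) * ‖x‖ ^ 2) := by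
  have : LinearMap.det ((ContinuousLinearEquiv.refl ℝ E : E ≃L[ℝ] E) : E →ₗ[ℝ] E) = 1 :=
    LinearMap.det_id
  rw [gaussianLogDensity, this, Real.rpow_def_of_pos (by positivity), ← Real.exp_add]
  simp
  ring_nf

variable [MeasurableSpace E] [BorelSpace E]

lemma measurable_gaussianLogDensity (L : E ≃L[ℝ] E) : Measurable (gaussianLogDensity L) := by
  unfold gaussianLogDensity
  fun_prop

variable [FiniteDimensional ℝ E]

/-- Both sides are finite measures with the same characteristic function, by the Gaussian Fourier
integral. -/
lemma stdGaussian_eq_withDensity :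
    stdGaussian E = volume.withDensity fun x =>
      ENNReal.ofReal (Real.exp (gaussianLogDensity (ContinuousLinearEquiv.refl ℝ E) x)) := by
  have hpos : (0 : ℝ) < (1 / 2 : ℂ).re := by norm_num
  have hcpos : (0 : ℝ) ≤ 2 * Real.pi := by positivity
  have hint : Integrable (fun x : E =>
      Real.exp (gaussianLogDensity (ContinuousLinearEquiv.refl ℝ E) x)) volume := by
    simp_rw [exp_gaussianLogDensity_refl]
    refine Integrable.const_mul ?_ _
    have := (GaussianFourier.integrable_cexp_neg_mul_sq_norm_add hpos 0 (0 : E)).re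
    refine this.congr (ae_of_all _ fun x => ?_)
    have h : (-(1 / 2 : ℂ) * (‖x‖ : ℂ) ^ 2 + 0 * (inner ℝ (0 : E) x : ℝ)) =
      ((-(1 / 2) * ‖x‖ ^ 2 : ℝ) : ℂ) := by push_cast; ring
    simp only [h]
    exact Complex.exp_ofReal_re _
  have : IsFiniteMeasure ((volume : Measure E).withDensity fun x =>
      ENNReal.ofReal (Real.exp (gaussianLogDensity (ContinuousLinearEquiv.refl ℝ E) x))) :=
    isFiniteMeasure_withDensity_ofReal hint.2
  refine Measure.ext_of_charFun (funext fun t => ?_)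
  rw [charFun_stdGaussian, charFun_apply,
    integral_withDensity_eq_integral_toReal_smul
      (measurable_gaussianLogDensity _).exp.ennreal_ofReal (ae_of_all _ fun _ => ENNReal.ofReal_lt_top)]
  have h := GaussianFourier.integral_cexp_neg_mul_sq_norm_add hpos Complex.I t
  have hc : ((2 * Real.pi : ℝ) ^ (-(Module.finrank ℝ E / 2 : ℝ)) : ℝ) *
      ((Real.pi / (1 / 2 : ℂ)) ^ (Module.finrank ℝ E / 2 : ℂ)) = 1 := by
    have h2 : (Real.pi / (1 / 2 : ℂ)) = ((2 * Real.pi : ℝ) : ℂ) := by push_cast; ring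
    have h3 : (Module.finrank ℝ E / 2 : ℂ) = ((Module.finrank ℝ E / 2 : ℝ) : ℂ) := by push_cast; ring
    rw [h2, h3, ← Complex.ofReal_cpow hcpos, ← Complex.ofReal_mul,
      ← Real.rpow_add (by positivity)]
    simp
  calc Complex.exp (-‖t‖ ^ 2 / 2)
      = ((2 * Real.pi : ℝ) ^ (-(Module.finrank ℝ E / 2 : ℝ)) : ℝ) *
        ∫ v : E, Complex.exp (-(1 / 2 : ℂ) * ‖v‖ ^ 2 + Complex.I * (inner ℝ t v : ℝ)) := by
        rw [h, ← mul_assoc, hc, one_mul, Complex.I_sq]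
        congr 1
        ring
    _ = _ := by
        rw [← integral_const_mul]
        refine integral_congr_ae (ae_of_all _ fun x => ?_)
        simp only
        rw [ENNReal.toReal_ofReal (Real.exp_pos _).le, exp_gaussianLogDensity_refl,
          Complex.exp_add, Complex.real_smul, real_inner_comm]
        push_cast
        rw [mul_comm Complex.I]
        ring

lemma map_stdGaussian_eq_withDensity (L : E ≃L[ℝ] E) :
    (stdGaussian E).map L = volume.withDensity fun x =>
      ENNReal.ofReal (Real.exp (gaussianLogDensity L x)) := by
  have hdet : LinearMap.det (L : E →ₗ[ℝ] E) ≠ 0 := (LinearEquiv.isUnit_det' L.toLinearEquiv).ne_zero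
  ext s hs
  rw [Measure.map_apply (by fun_prop) hs, stdGaussian_eq_withDensity,
    withDensity_apply _ (L.continuous.measurable hs), withDensity_apply _ hs]
  have hvol : (volume : Measure E) =
      ENNReal.ofReal |LinearMap.det (L : E →ₗ[ℝ] E)| • Measure.map L volume := by
    have := Measure.map_linearMap_addHaar_eq_smul_addHaar (volume : Measure E) hdet
    have h2 : Measure.map L (volume : Measure E) =
      ENNReal.ofReal |(LinearMap.det (L : E →ₗ[ℝ] E))⁻¹| • volume := this
    rw [h2, smul_smul, ← ENNReal.ofReal_mul (abs_nonneg _), ← abs_mul, mul_inv_cancel₀ hdet]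
    simp
  conv_rhs => rw [hvol]
  rw [Measure.restrict_smul, lintegral_smul_measure, setLIntegral_map hs
    (measurable_gaussianLogDensity _).exp.ennreal_ofReal L.continuous.measurable, smul_eq_mul,
    ← lintegral_const_mul' _ _ ENNReal.ofReal_ne_top]
  refine lintegral_congr fun x => ?_
  rw [← ENNReal.ofReal_mul (abs_nonneg _)]
  congr 1
  rw [← Real.exp_log (abs_pos.2 hdet)]
  rw [← Real.exp_add]
  have : LinearMap.det ((ContinuousLinearEquiv.refl ℝ E : E ≃L[ℝ] E) : E →ₗ[ℝ] E) = 1 :=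
    LinearMap.det_id
  simp [gaussianLogDensity, this]
  ring

lemma integrable_sq_norm_stdGaussian : Integrable (fun x : E => ‖x‖ ^ 2) (stdGaussian E) :=
  (IsGaussian.memLp_two_id (μ := stdGaussian E)).integrable_norm_pow two_ne_zero

lemma integrable_gaussianLogDensity (L : E ≃L[ℝ] E) :
    Integrable (gaussianLogDensity L) ((stdGaussian E).map L) := by
  rw [integrable_map_measure (measurable_gaussianLogDensity L).aestronglyMeasurable (by fun_prop)]
  simp only [gaussianLogDensity, Function.comp_def, ContinuousLinearEquiv.symm_apply_apply]
  exact (integrable_const _).sub (integrable_sq_norm_stdGaussian.div_const 2)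

/-- Pulling back along `L` makes the quadratic term independent of `L`, so for two maps these
integrals differ only through the log-determinants. -/
lemma integral_gaussianLogDensity (L : E ≃L[ℝ] E) :
    ∫ x, gaussianLogDensity L x ∂((stdGaussian E).map L) =
      -(Module.finrank ℝ E / 2 * Real.log (2 * Real.pi)) -
        Real.log |LinearMap.det (L : E →ₗ[ℝ] E)| - ∫ x : E, ‖x‖ ^ 2 / 2 ∂(stdGaussian E) := by
  rw [integral_map (by fun_prop) (measurable_gaussianLogDensity L).aestronglyMeasurable]
  simp only [gaussianLogDensity, ContinuousLinearEquiv.symm_apply_apply]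
  rw [integral_sub (integrable_const _) (integrable_sq_norm_stdGaussian.div_const 2)]
  simp

/-- Density of the joint law of `(X, H X + η)` with respect to the law of `X` times volume. -/
lemma map_shear_prod_withDensity {F : Type*} [MeasurableSpace F] (γ : Measure F)
    [IsProbabilityMeasure γ] {H : F → E} (hH : Measurable H) {f : E → ℝ≥0∞} (hf : Measurable f)
    [SFinite ((volume : Measure E).withDensity f)] :
    (γ.prod (volume.withDensity f)).map (fun p => (p.1, H p.1 + p.2)) =
      (γ.prod volume).withDensity fun p => f (p.2 - H p.1) := by
  -- On each fibre the shear is a translation, which preserves Lebesgue measure.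
  have hmp : MeasurePreserving (fun p : F × E => (p.1, H p.1 + p.2)) (γ.prod volume)
      (γ.prod volume) :=
    (MeasurePreserving.id γ).skew_product (g := fun x e => H x + e) (by fun_prop)
      (ae_of_all _ fun x => map_add_left_eq_self volume (H x))
  have hf' : Measurable fun p : F × E => f (p.2 - H p.1) := by fun_prop
  rw [prod_withDensity_right hf]
  ext s hs
  rw [Measure.map_apply hmp.measurable hs, withDensity_apply _ (hmp.measurable hs),
    withDensity_apply _ hs, ← hmp.map_eq, setLIntegral_map hs hf' hmp.measurable, hmp.map_eq]
  simp

/-- Relative entropy of the joint law of `(X, H X + η)`, with Gaussian noise `η`, with respect to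
the product of the marginals. -/
lemma klDiv_map_shear_prod_stdGaussian {F : Type*} [MeasurableSpace F] (γ : Measure F)
    [IsProbabilityMeasure γ] {H : F → E} (hH : Measurable H) (S T : E ≃L[ℝ] E)
    (hT : (γ.prod ((stdGaussian E).map S)).map (fun p => H p.1 + p.2) = (stdGaussian E).map T) :
    InformationTheory.klDiv ((γ.prod ((stdGaussian E).map S)).map (fun p => (p.1, H p.1 + p.2)))
        (γ.prod ((stdGaussian E).map T)) ≠ ∞ ∧
      (InformationTheory.klDiv
        ((γ.prod ((stdGaussian E).map S)).map (fun p => (p.1, H p.1 + p.2)))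
        (γ.prod ((stdGaussian E).map T))).toReal =
        Real.log |LinearMap.det (T : E →ₗ[ℝ] E)| - Real.log |LinearMap.det (S : E →ₗ[ℝ] E)| := by
  have hpS : IsProbabilityMeasure ((stdGaussian E).map S) :=
    Measure.isProbabilityMeasure_map (by fun_prop)
  have hpT : IsProbabilityMeasure ((stdGaussian E).map T) :=
    Measure.isProbabilityMeasure_map (by fun_prop)
  have hφ : Measurable fun p : F × E => (p.1, H p.1 + p.2) := by fun_prop
  set J := (γ.prod ((stdGaussian E).map S)).map (fun p => (p.1, H p.1 + p.2)) with hJ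
  have hpJ : IsProbabilityMeasure J := Measure.isProbabilityMeasure_map hφ.aemeasurable
  have hmS := measurable_gaussianLogDensity S
  have hmT := measurable_gaussianLogDensity T
  -- The log-likelihood ratio: conditional log-density of the output given the input, minus its
  -- marginal log-density.
  set r : F × E → ℝ := fun p => gaussianLogDensity S (p.2 - H p.1) - gaussianLogDensity T p.2
    with hr
  have hrm : Measurable r := by fun_prop
  have hJd : J = (γ.prod ((stdGaussian E).map T)).withDensity
      fun p => ENNReal.ofReal (Real.exp (r p)) := by
    have hS' := map_stdGaussian_eq_withDensity S
    have hT' := map_stdGaussian_eq_withDensity T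
    have : SFinite ((volume : Measure E).withDensity fun x =>
        ENNReal.ofReal (Real.exp (gaussianLogDensity S x))) := hS' ▸ inferInstance
    have : SFinite ((volume : Measure E).withDensity fun x =>
        ENNReal.ofReal (Real.exp (gaussianLogDensity T x))) := hT' ▸ inferInstance
    rw [hJ, hS', hT', map_shear_prod_withDensity γ hH hmS.exp.ennreal_ofReal,
      prod_withDensity_right hmT.exp.ennreal_ofReal,
      ← withDensity_mul _ (by fun_prop) (by fun_prop)]
    congr 1
    funext p
    rw [Pi.mul_apply, ← ENNReal.ofReal_mul (Real.exp_pos _).le, ← Real.exp_add, hr]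
    simp
  have hac : J ≪ γ.prod ((stdGaussian E).map T) := by
    rw [hJd]; exact withDensity_absolutelyContinuous _ _
  have hllr : llr J (γ.prod ((stdGaussian E).map T)) =ᵐ[J] r := by
    have h := Measure.rnDeriv_withDensity (γ.prod ((stdGaussian E).map T))
      (f := fun p => ENNReal.ofReal (Real.exp (r p))) (by fun_prop)
    rw [← hJd] at h
    filter_upwards [hac.ae_le h] with p hp
    rw [llr, hp, ENNReal.toReal_ofReal (Real.exp_pos _).le, Real.log_exp]
  -- Under `J` the output has law `T` of the standard Gaussian, and subtracting `H p.1` recovers the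
  -- noise. Each term of `r` is thus integrated against its own Gaussian law.
  have hJ2 : J.map Prod.snd = (stdGaussian E).map T := by
    rw [hJ, Measure.map_map measurable_snd hφ, ← hT]; rfl
  have hJ1 : J.map (fun p => p.2 - H p.1) = (stdGaussian E).map S := by
    rw [hJ, Measure.map_map (by fun_prop) hφ]
    have : (fun p : F × E => p.2 - H p.1) ∘ (fun p => (p.1, H p.1 + p.2)) = Prod.snd := by
      funext p; simp
    rw [this]
    exact Measure.snd_prod
  have hi1 : Integrable (fun p : F × E => gaussianLogDensity S (p.2 - H p.1)) J := by
    have := integrable_gaussianLogDensity S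
    rw [← hJ1] at this
    exact this.comp_measurable (by fun_prop)
  have hi2 : Integrable (fun p : F × E => gaussianLogDensity T p.2) J := by
    have := integrable_gaussianLogDensity T
    rw [← hJ2] at this
    exact this.comp_measurable measurable_snd
  have hint : Integrable (llr J (γ.prod ((stdGaussian E).map T))) J :=
    (integrable_congr hllr).2 (hi1.sub hi2)
  refine ⟨InformationTheory.klDiv_ne_top hac hint, ?_⟩
  rw [InformationTheory.toReal_klDiv_of_measure_eq hac (by simp), integral_congr_ae hllr, hr,
    integral_sub hi1 hi2]
  have e1 : ∫ p, gaussianLogDensity S (p.2 - H p.1) ∂J =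
      ∫ x, gaussianLogDensity S x ∂((stdGaussian E).map S) := by
    rw [← hJ1, integral_map (by fun_prop) hmS.aestronglyMeasurable]
  have e2 : ∫ p, gaussianLogDensity T p.2 ∂J =
      ∫ x, gaussianLogDensity T x ∂((stdGaussian E).map T) := by
    rw [← hJ2, integral_map (by fun_prop) hmT.aestronglyMeasurable]
  rw [e1, e2, integral_gaussianLogDensity, integral_gaussianLogDensity]
  ring

end GaussianDensity

/-! ### Multivariate Gaussians and the linear model. -/

open scoped MatrixOrder in
-- The map is the square root of `S`, invertible because its determinant squares to `det S > 0`;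
-- this is the source of the factor `1 / 2`.
lemma exists_multivariateGaussian_eq_map {k : ℕ} {S : Matrix (Fin k) (Fin k) ℝ} (hS : S.PosDef) :
    ∃ T : EuclideanSpace ℝ (Fin k) ≃L[ℝ] EuclideanSpace ℝ (Fin k),
      multivariateGaussian 0 S = (stdGaussian (EuclideanSpace ℝ (Fin k))).map T ∧
      Real.log |LinearMap.det (T : EuclideanSpace ℝ (Fin k) →ₗ[ℝ] EuclideanSpace ℝ (Fin k))| =
        1 / 2 * Real.log S.det := by
  have hsq : CFC.sqrt S * CFC.sqrt S = S := CFC.sqrt_mul_sqrt_self _ hS.posSemidef.nonneg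
  have hdet : (CFC.sqrt S).det * (CFC.sqrt S).det = S.det := by rw [← det_mul, hsq]
  have hd : (toEuclideanCLM (𝕜 := ℝ) (CFC.sqrt S)).det = (CFC.sqrt S).det :=
    LinearMap.det_toLin (EuclideanSpace.basisFun (Fin k) ℝ).toBasis (CFC.sqrt S)
  have hne : (CFC.sqrt S).det ≠ 0 := by
    intro h
    rw [h, zero_mul] at hdet
    exact hS.det_pos.ne hdet
  refine ⟨(toEuclideanCLM (𝕜 := ℝ) (CFC.sqrt S)).toContinuousLinearEquivOfDetNeZero (hd ▸ hne),
    ?_, ?_⟩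
  · simp only [multivariateGaussian, zero_add]
    rfl
  · have : LinearMap.det (((toEuclideanCLM (𝕜 := ℝ)
        (CFC.sqrt S)).toContinuousLinearEquivOfDetNeZero (hd ▸ hne) :
          EuclideanSpace ℝ (Fin k) ≃L[ℝ] EuclideanSpace ℝ (Fin k)) :
          EuclideanSpace ℝ (Fin k) →ₗ[ℝ] EuclideanSpace ℝ (Fin k)) = (CFC.sqrt S).det := hd
    rw [this, ← hdet, Real.log_mul hne hne, Real.log_abs]
    ring

/-- A matrix as a map between Euclidean spaces. -/
noncomputable def euclideanMulVec {m n : ℕ} (A : Matrix (Fin m) (Fin n) ℝ) :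
    EuclideanSpace ℝ (Fin n) →L[ℝ] EuclideanSpace ℝ (Fin m) :=
  LinearMap.toContinuousLinearMap (toEuclideanLin A)

lemma euclideanMulVec_apply {m n : ℕ} (A : Matrix (Fin m) (Fin n) ℝ)
    (x : EuclideanSpace ℝ (Fin n)) : euclideanMulVec A x = WithLp.toLp 2 (A *ᵥ x.ofLp) := rfl

lemma inner_euclideanMulVec {m n : ℕ} (A : Matrix (Fin m) (Fin n) ℝ)
    (x : EuclideanSpace ℝ (Fin n)) (t : EuclideanSpace ℝ (Fin m)) :
    inner ℝ (euclideanMulVec A x) t = inner ℝ x (euclideanMulVec Aᵀ t) := by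
  simp only [euclideanMulVec_apply, EuclideanSpace.inner_eq_star_dotProduct, star_trivial]
  rw [dotProduct_mulVec, mulVec_transpose]

lemma charFun_map_euclideanMulVec {m n : ℕ} (A : Matrix (Fin m) (Fin n) ℝ)
    (ν : Measure (EuclideanSpace ℝ (Fin n))) (t : EuclideanSpace ℝ (Fin m)) :
    charFun (ν.map (euclideanMulVec A)) t = charFun ν (euclideanMulVec Aᵀ t) := by
  rw [charFun_apply, integral_map (by fun_prop) (by fun_prop), charFun_apply]
  simp only [inner_euclideanMulVec]

lemma map_euclideanMulVec_multivariateGaussian {m n : ℕ} (A : Matrix (Fin m) (Fin n) ℝ)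
    {S : Matrix (Fin n) (Fin n) ℝ} (hS : S.PosSemidef) :
    (multivariateGaussian 0 S).map (euclideanMulVec A) = multivariateGaussian 0 (A * S * Aᵀ) := by
  have hS' : (A * S * Aᵀ).PosSemidef := by
    simpa [conjTranspose_eq_transpose_of_trivial] using hS.mul_mul_conjTranspose_same A
  have : IsProbabilityMeasure ((multivariateGaussian 0 S).map (euclideanMulVec A)) :=
    Measure.isProbabilityMeasure_map (by fun_prop)
  refine Measure.ext_of_charFun (funext fun t => ?_)
  rw [charFun_map_euclideanMulVec, charFun_multivariateGaussian hS,
    charFun_multivariateGaussian hS']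
  simp only [inner_zero_right, euclideanMulVec_apply]
  rw [← mulVec_mulVec, ← mulVec_mulVec, dotProduct_mulVec t.ofLp A, mulVec_transpose]

lemma map_add_prod_multivariateGaussian {k : ℕ} {S T : Matrix (Fin k) (Fin k) ℝ}
    (hS : S.PosSemidef) (hT : T.PosSemidef) :
    ((multivariateGaussian 0 S).prod (multivariateGaussian 0 T)).map (fun p => p.1 + p.2) =
      multivariateGaussian 0 (S + T) := by
  have : (multivariateGaussian 0 S).conv (multivariateGaussian 0 T) =
      multivariateGaussian 0 (S + T) := by
    refine Measure.ext_of_charFun (funext fun t => ?_)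
    rw [charFun_conv, charFun_multivariateGaussian hS, charFun_multivariateGaussian hT,
      charFun_multivariateGaussian (hS.add hT), ← Complex.exp_add, add_mulVec, dotProduct_add]
    congr 1
    simp
    ring
  exact this

/-- Mutual information of a Gaussian linear model `Z = H X + η`. -/
lemma mutualInformation_gaussian_linear_model {Ω : Type*} [MeasurableSpace Ω] {μ : Measure Ω}
    [IsProbabilityMeasure μ] {n k : ℕ} {H : Matrix (Fin k) (Fin n) ℝ}
    {R : Matrix (Fin n) (Fin n) ℝ} (hR : R.PosSemidef)
    {S T : Matrix (Fin k) (Fin k) ℝ} (hS : S.PosDef) (hT : T.PosDef) (hTS : T = H * R * Hᵀ + S)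
    {X : Ω → EuclideanSpace ℝ (Fin n)} {η Z : Ω → EuclideanSpace ℝ (Fin k)}
    (hX : HasLaw X (multivariateGaussian 0 R) μ) (hη : HasLaw η (multivariateGaussian 0 S) μ)
    (hind : IndepFun X η μ) (hZ : Z =ᵐ[μ] fun ω => euclideanMulVec H (X ω) + η ω) :
    mutualInformation X Z μ ≠ ∞ ∧
      (mutualInformation X Z μ).toReal = 1 / 2 * (Real.log T.det - Real.log S.det) := by
  obtain ⟨A, hA, hAdet⟩ := exists_multivariateGaussian_eq_map hS
  obtain ⟨B, hB, hBdet⟩ := exists_multivariateGaussian_eq_map hT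
  have hprod : μ.map (fun ω => (X ω, η ω)) =
      (multivariateGaussian 0 R).prod (multivariateGaussian 0 S) := by
    rw [(indepFun_iff_map_prod_eq_prod_map_map hX.aemeasurable hη.aemeasurable).1 hind,
      hX.map_eq, hη.map_eq]
  have hXη : AEMeasurable (fun ω => (X ω, η ω)) μ := hX.aemeasurable.prodMk hη.aemeasurable
  have hφ : Measurable fun p : EuclideanSpace ℝ (Fin n) × EuclideanSpace ℝ (Fin k) =>
    (p.1, euclideanMulVec H p.1 + p.2) := by fun_prop
  have hψ : Measurable fun p : EuclideanSpace ℝ (Fin n) × EuclideanSpace ℝ (Fin k) =>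
    euclideanMulVec H p.1 + p.2 := by fun_prop
  have hjoint : μ.map (fun ω => (X ω, Z ω)) =
      ((multivariateGaussian 0 R).prod (multivariateGaussian 0 S)).map
        (fun p => (p.1, euclideanMulVec H p.1 + p.2)) := by
    rw [← hprod, AEMeasurable.map_map_of_aemeasurable hφ.aemeasurable hXη]
    refine Measure.map_congr ?_
    filter_upwards [hZ] with ω hω
    simp [hω]
  have hsum : ((multivariateGaussian 0 R).prod (multivariateGaussian 0 S)).map
        (fun p => euclideanMulVec H p.1 + p.2) = multivariateGaussian 0 T := by
    have hHR : (H * R * Hᵀ).PosSemidef := by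
      simpa [conjTranspose_eq_transpose_of_trivial] using hR.mul_mul_conjTranspose_same H
    rw [hTS, ← map_add_prod_multivariateGaussian hHR hS.posSemidef,
      ← map_euclideanMulVec_multivariateGaussian H hR]
    -- Writing the noise law as its image under the identity exhibits the product as an image of a
    -- product measure.
    conv_rhs => rw [← Measure.map_id (μ := multivariateGaussian 0 S)]
    rw [Measure.map_prod_map _ _ (by fun_prop) (by fun_prop),
      Measure.map_map (by fun_prop) (by fun_prop)]
    rfl
  have hZlaw : μ.map Z = multivariateGaussian 0 T := by
    rw [← hsum, ← hprod, AEMeasurable.map_map_of_aemeasurable hψ.aemeasurable hXη]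
    exact Measure.map_congr hZ
  have key := klDiv_map_shear_prod_stdGaussian (multivariateGaussian 0 R)
    (euclideanMulVec H).continuous.measurable A B (by rw [← hA, ← hB, hsum])
  rw [← hA, ← hB, ← hjoint, hAdet, hBdet] at key
  rw [mutualInformation, hX.map_eq, hZlaw]
  exact ⟨key.1, key.2.trans (by ring)⟩

/-! ### Selection operators and the four bounds. -/

lemma IsSelectionOperator.transpose_mul_self {m k : ℕ} {P : Matrix (Fin m) (Fin k) ℝ}
    (hP : IsSelectionOperator P) : Pᵀ * P = 1 := by
  obtain ⟨i, hi, h⟩ := hP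
  ext a b
  simp [Matrix.mul_apply, h, one_apply, hi.eq_iff, eq_comm]

lemma IsSelectionOperator.exists_compression_eq_submatrix {m k : ℕ}
    {P : Matrix (Fin m) (Fin k) ℝ} (hP : IsSelectionOperator P) :
    ∃ i : Fin k → Fin m, Function.Injective i ∧
      (selectionIndexSet P = Finset.univ.image i) ∧
      ∀ M : Matrix (Fin m) (Fin m) ℝ, Pᵀ * M * P = M.submatrix i i := by
  obtain ⟨i, hi, h⟩ := hP
  refine ⟨i, hi, ?_, fun M => ?_⟩
  · ext a
    simp [selectionIndexSet, h, eq_comm]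
  · ext a b
    simp [Matrix.mul_apply, h]

/-- Compression by a selection operator is a principal submatrix, so its trace sums the diagonal
entries of `M` over the index set, each counted once by injectivity. -/
lemma halfTraceIsModular {m : ℕ} (M : Matrix (Fin m) (Fin m) ℝ) : HalfTraceIsModular M := by
  refine ⟨fun A => ∑ a ∈ A, 1 / 2 * M a a, ⟨fun a => 1 / 2 * M a a, fun A => rfl⟩,
    fun k P hP => ?_⟩
  obtain ⟨i, hi, hs, h⟩ := hP.exists_compression_eq_submatrix
  beta_reduce
  rw [halfTrace, h, hs, Finset.sum_image fun a _ b _ hab => hi hab, Matrix.trace, Finset.mul_sum]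
  rfl

lemma halfTrace_add {m k : ℕ} (M N : Matrix (Fin m) (Fin m) ℝ) (P : Matrix (Fin m) (Fin k) ℝ) :
    halfTrace (M + N) P = halfTrace M P + halfTrace N P := by
  simp [halfTrace, Matrix.mul_add, Matrix.add_mul, mul_add]

lemma halfTrace_sub {m k : ℕ} (M N : Matrix (Fin m) (Fin m) ℝ) (P : Matrix (Fin m) (Fin k) ℝ) :
    halfTrace (M - N) P = halfTrace M P - halfTrace N P := by
  simp [halfTrace, Matrix.mul_sub, Matrix.sub_mul, mul_sub]

lemma IsSelectionOperator.halfTrace_smul_one {m k : ℕ} {P : Matrix (Fin m) (Fin k) ℝ}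
    (hP : IsSelectionOperator P) (c : ℝ) :
    halfTrace (c • (1 : Matrix (Fin m) (Fin m) ℝ)) P = 1 / 2 * (k * c) := by
  simp [halfTrace, hP.transpose_mul_self, mul_comm]

lemma IsSelectionOperator.posDef_compression {m k : ℕ} {P : Matrix (Fin m) (Fin k) ℝ}
    (hP : IsSelectionOperator P) {A : Matrix (Fin m) (Fin m) ℝ} (hA : A.PosDef) :
    (Pᵀ * A * P).PosDef := by
  obtain ⟨i, hi, -, h⟩ := hP.exists_compression_eq_submatrix
  rw [h]
  exact hA.submatrix hi

lemma IsSelectionOperator.log_det_le_trace_matrixLog_diagPart {m k : ℕ}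
    {P : Matrix (Fin m) (Fin k) ℝ} (hP : IsSelectionOperator P)
    {A : Matrix (Fin m) (Fin m) ℝ} (hA : A.PosDef) :
    Real.log (Pᵀ * A * P).det ≤ (Pᵀ * matrixLog (diagPart A) * P).trace := by
  have hB := hP.posDef_compression hA
  obtain ⟨i, hi, -, h⟩ := hP.exists_compression_eq_submatrix
  refine (log_det_le_sum_log_diag hB).trans_eq ?_
  rw [h, h]
  simp [Matrix.trace, matrixLog_diagPart_apply_self]

lemma mutualInformation_selectObservations {Ω : Type*} [MeasurableSpace Ω] {μ : Measure Ω}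
    [IsProbabilityMeasure μ] {n m : ℕ} {G : Matrix (Fin m) (Fin n) ℝ}
    {ΓX : Matrix (Fin n) (Fin n) ℝ} (hΓX : ΓX.PosDef)
    {ΓYX : Matrix (Fin m) (Fin m) ℝ} (hΓYX : ΓYX.PosDef)
    {X : Ω → EuclideanSpace ℝ (Fin n)} {ε Y : Ω → EuclideanSpace ℝ (Fin m)}
    (hX : HasLaw X (multivariateGaussian 0 ΓX) μ)
    (hε : HasLaw ε (multivariateGaussian 0 ΓYX) μ)
    (hXε : IndepFun X ε μ)
    (hY : ∀ᵐ ω ∂μ, Y ω = WithLp.toLp 2 (G *ᵥ (X ω).ofLp) + ε ω)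
    (hΓY : (dataCovariance G ΓX ΓYX).PosDef)
    {k : ℕ} {P : Matrix (Fin m) (Fin k) ℝ} (hP : IsSelectionOperator P) :
    mutualInformation X (selectObservations P Y) μ ≠ ∞ ∧
      (mutualInformation X (selectObservations P Y) μ).toReal =
        1 / 2 * (Real.log (Pᵀ * dataCovariance G ΓX ΓYX * P).det -
          Real.log (Pᵀ * ΓYX * P).det) := by
  refine mutualInformation_gaussian_linear_model (H := Pᵀ * G)
    (η := fun ω => euclideanMulVec Pᵀ (ε ω)) hΓX.posSemidef
    (hP.posDef_compression hΓYX) (hP.posDef_compression hΓY) ?_ hX ⟨?_, ?_⟩ ?_ ?_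
  · simp only [dataCovariance, transpose_mul, transpose_transpose, Matrix.mul_add, Matrix.add_mul,
      Matrix.mul_assoc]
  · exact (euclideanMulVec Pᵀ).continuous.measurable.comp_aemeasurable hε.aemeasurable
  · have h := map_euclideanMulVec_multivariateGaussian Pᵀ hΓYX.posSemidef
    rw [transpose_transpose, ← hε.map_eq,
      AEMeasurable.map_map_of_aemeasurable (by fun_prop) hε.aemeasurable] at h
    exact h
  · exact hXε.comp measurable_id (euclideanMulVec Pᵀ).continuous.measurable
  · filter_upwards [hY] with ω hω
    rw [selectObservations, ← euclideanMulVec_apply, hω, map_add]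
    simp [euclideanMulVec_apply]

theorem mainTheorem6 {Ω : Type*} [MeasurableSpace Ω] (μ : Measure Ω) [IsProbabilityMeasure μ]
    (n m : ℕ)
    (G : Matrix (Fin m) (Fin n) ℝ)
    (ΓX : Matrix (Fin n) (Fin n) ℝ) (hΓX : ΓX.PosDef)
    -- `ΓYX` is the noise covariance `Γ_{Y|X}`, `ΓY` the marginal covariance of the data
    (ΓYX : Matrix (Fin m) (Fin m) ℝ) (hΓYX : ΓYX.PosDef)
    (ΓY : Matrix (Fin m) (Fin m) ℝ) (hΓY : ΓY = dataCovariance G ΓX ΓYX)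
    (X : Ω → EuclideanSpace ℝ (Fin n)) (ε Y : Ω → EuclideanSpace ℝ (Fin m))
    (hX : HasLaw X (multivariateGaussian 0 ΓX) μ)
    (hε : HasLaw ε (multivariateGaussian 0 ΓYX) μ)
    (hXε : IndepFun X ε μ)
    (hY : ∀ᵐ ω ∂μ, Y ω = WithLp.toLp 2 (G *ᵥ (X ω).ofLp) + ε ω) :
    -- the two bounds
    (HalfTraceIsModular (matrixLog ΓY - matrixLog (diagPart ΓYX)) ∧
      HalfTraceIsModular (matrixLog (diagPart ΓY) - matrixLog ΓYX) ∧
      ∀ (k : ℕ) (P : Matrix (Fin m) (Fin k) ℝ), IsSelectionOperator P →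
        mutualInformation X (selectObservations P Y) μ ≠ ∞ ∧
        halfTrace (matrixLog ΓY - matrixLog (diagPart ΓYX)) P ≤
          (mutualInformation X (selectObservations P Y) μ).toReal ∧
        (mutualInformation X (selectObservations P Y) μ).toReal ≤
          halfTrace (matrixLog (diagPart ΓY) - matrixLog ΓYX) P) ∧
    -- the alternative bounds with the Kantorovich constants
    (∀ αs αl βs βl : ℝ, 0 < αs → αs ≤ αl → spectrum ℝ ΓYX ⊆ Set.Icc αs αl →
      0 < βs → βs ≤ βl → spectrum ℝ ΓY ⊆ Set.Icc βs βl →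
      kantorovichConstant αs αl ∈ Set.Ioc 0 1 ∧
      kantorovichConstant βs βl ∈ Set.Ioc 0 1 ∧
      HalfTraceIsModular (matrixLog ΓY - matrixLog ΓYX +
        Real.log (kantorovichConstant αs αl) • (1 : Matrix (Fin m) (Fin m) ℝ)) ∧
      HalfTraceIsModular (matrixLog ΓY -
        Real.log (kantorovichConstant βs βl) • (1 : Matrix (Fin m) (Fin m) ℝ) - matrixLog ΓYX) ∧
      ∀ (k : ℕ) (P : Matrix (Fin m) (Fin k) ℝ), IsSelectionOperator P →
        halfTrace (matrixLog ΓY - matrixLog ΓYX +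
            Real.log (kantorovichConstant αs αl) • (1 : Matrix (Fin m) (Fin m) ℝ)) P ≤
          (mutualInformation X (selectObservations P Y) μ).toReal ∧
        (mutualInformation X (selectObservations P Y) μ).toReal ≤
          halfTrace (matrixLog ΓY -
            Real.log (kantorovichConstant βs βl) • (1 : Matrix (Fin m) (Fin m) ℝ) -
              matrixLog ΓYX) P) := by
  subst hΓY
  have hΓYpd : (dataCovariance G ΓX ΓYX).PosDef := by
    have : (G * ΓX * Gᵀ).PosSemidef := by
      simpa [conjTranspose_eq_transpose_of_trivial] using
        hΓX.posSemidef.mul_mul_conjTranspose_same G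
    exact hΓYX.posSemidef_add this
  have hI := fun (k : ℕ) (P : Matrix (Fin m) (Fin k) ℝ) (hP : IsSelectionOperator P) =>
    mutualInformation_selectObservations hΓX hΓYX hX hε hXε hY hΓYpd hP
  refine ⟨⟨halfTraceIsModular _, halfTraceIsModular _, fun k P hP => ⟨(hI k P hP).1, ?_, ?_⟩⟩,
    fun αs αl βs βl hα0 hα hαs hβ0 hβ hβs =>
      ⟨⟨kantorovichConstant_pos hα0 hα, kantorovichConstant_le_one hα0 hα⟩,
        ⟨kantorovichConstant_pos hβ0 hβ, kantorovichConstant_le_one hβ0 hβ⟩,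
        halfTraceIsModular _, halfTraceIsModular _, fun k P hP => ⟨?_, ?_⟩⟩⟩
  · rw [(hI k P hP).2, halfTrace_sub, halfTrace, halfTrace]
    linarith [trace_compression_matrixLog_le hΓYpd hP.transpose_mul_self
      (hP.posDef_compression hΓYpd), hP.log_det_le_trace_matrixLog_diagPart hΓYX]
  · rw [(hI k P hP).2, halfTrace_sub, halfTrace, halfTrace]
    linarith [trace_compression_matrixLog_le hΓYX hP.transpose_mul_self
      (hP.posDef_compression hΓYX), hP.log_det_le_trace_matrixLog_diagPart hΓYpd]
  -- The reverse Jensen bound for the noise covariance now replaces Hadamard; its loss `k log ϱ₁` is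
  -- exactly the trace of the compressed scalar matrix.
  · rw [(hI k P hP).2, halfTrace_add, halfTrace_sub, hP.halfTrace_smul_one, halfTrace, halfTrace]
    linarith [trace_compression_matrixLog_le hΓYpd hP.transpose_mul_self
      (hP.posDef_compression hΓYpd), log_det_compression_add_le hΓYX hα0 hα hαs
        hP.transpose_mul_self (hP.posDef_compression hΓYX)]
  · rw [(hI k P hP).2, halfTrace_sub, halfTrace_sub, hP.halfTrace_smul_one, halfTrace, halfTrace]
    linarith [trace_compression_matrixLog_le hΓYX hP.transpose_mul_self
      (hP.posDef_compression hΓYX), log_det_compression_add_le hΓYpd hβ0 hβ hβs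
        hP.transpose_mul_self (hP.posDef_compression hΓYpd)]
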